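/- For a positive integer $d$, a $d$-dimensional (mixed) state is a positive semidefinite $d\times d$ complex matrix of trace $1$, and $\|X\|_1$ denotes the trace norm (the sum of the absolute values of the eigenvalues of a Hermitian matrix $X$). For positive integers $e\le d$ and an isometry $V:\mathbb{C}^d\to\mathbb{C}^e\otimes\mathbb{C}^{\lceil d/e\rceil}$, let $\mathcal{E}_V(X)=\mathrm{tr}_2[VXV^\dagger]$ be the quantum channel that performs $V$ and then traces out the second tensor factor. A uniformly random isometry is $V=UV_0$, where $V_0$ is any fixed isometry and $U$ is a Haar-distributed unitary operator on $\mathbb{C}^e\otimes\mathbb{C}^{\lceil d/e\rceil}$. Fix $0<\epsilon<1$ and put $K=\frac{1-\ln 2}{2\ln 2}\approx 0.22$. (a) Let $d$ be a positive integer and let $\rho,\sigma$ be arbitrary $d$-dimensional mixed states such that $\rho$ has rank $r$. For any integer $e$ with $2\sqrt{rd/\epsilon}\le e\le d$ and $V$ uniformly random, $$\Pr_V\big[\,\|\mathcal{E}_V(\rho)-\mathcal{E}_V(\sigma)\|_1\ge(1-\epsilon)\|\rho-\sigma\|_1\,\big]\ \ge\ 1-d\exp(-K\epsilon d).$$ (b)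 Consequently, states of rank at most $r$ embed into $O(\sqrt{rd})$ dimensions: there is a constant $C>0$ depending only on $\epsilon$ such that for all integers $1\le r\le d$ there is an integer $1\le e\le d$ with $e\le C\sqrt{rd}$ for which, for $V$ uniformly random, $\mathcal{E}_V$ is a random quantum channel (completely positive trace-preserving map) and, for all $d$-dimensional states $\rho,\sigma$ of rank at most $r$, $$\Pr_V\big[\,(1-\epsilon)\|\rho-\sigma\|_1\le\|\mathcal{E}_V(\rho)-\mathcal{E}_V(\sigma)\|_1\le\|\rho-\sigma\|_1\,\big]\ \ge\ 1-d\exp(-K\epsilon d).$$ -/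

import Mathlib

open Matrix MeasureTheory

noncomputable section

namespace QEmbed

open scoped ComplexOrder

/-! ### States, trace norm, channels -/

/-- A (mixed) quantum state: a positive semidefinite matrix of trace one. -/
def IsState {n : Type*} [Fintype n] (ρ : Matrix n n ℂ) : Prop :=
  ρ.PosSemidef ∧ ρ.trace = 1

/-- The trace norm (Schatten 1-norm): the sum of the singular values, i.e. of the square roots of
the eigenvalues of `Xᴴ * X`. For Hermitian `X` it is the sum of the absolute values of the
eigenvalues, see `traceNorm_eq_sum_abs_eigenvalues`. -/
def traceNorm {n : Type*} [Fintype n] [DecidableEq n] (X : Matrix n n ℂ) : ℝ :=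
  ∑ i, √((isHermitian_conjTranspose_mul_self X).eigenvalues i)

theorem traceNorm_eq_sum_abs_eigenvalues {n : Type*} [Fintype n] [DecidableEq n]
    {X : Matrix n n ℂ} (hX : X.IsHermitian) : traceNorm X = ∑ i, |hX.eigenvalues i| := by
  have h1 := (isHermitian_conjTranspose_mul_self X).roots_charpoly_eq_eigenvalues
  have h2 : (Xᴴ * X).charpoly =
      (diagonal (fun i => ((hX.eigenvalues i ^ 2 : ℝ) : ℂ))).charpoly := by
    have hs : Xᴴ * X = (hX.eigenvectorUnitary : Matrix n n ℂ) *
        diagonal (fun i => ((hX.eigenvalues i ^ 2 : ℝ) : ℂ)) *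
        (hX.eigenvectorUnitary : Matrix n n ℂ)ᴴ := by
      have hU : (hX.eigenvectorUnitary : Matrix n n ℂ)ᴴ * (hX.eigenvectorUnitary : Matrix n n ℂ)
          = 1 := Unitary.coe_star_mul_self hX.eigenvectorUnitary
      have hsp := hX.spectral_theorem
      rw [Unitary.conjStarAlgAut_apply, star_eq_conjTranspose] at hsp
      have hd : diagonal (fun i => ((hX.eigenvalues i ^ 2 : ℝ) : ℂ)) =
          diagonal (RCLike.ofReal ∘ hX.eigenvalues : n → ℂ) *
            diagonal (RCLike.ofReal ∘ hX.eigenvalues : n → ℂ) := by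
        rw [diagonal_mul_diagonal]
        congr 1
        funext i
        simp [sq]
      rw [hX.eq, hd]
      conv_lhs => rw [hsp]
      simp only [Matrix.mul_assoc]
      rw [← Matrix.mul_assoc (hX.eigenvectorUnitary : Matrix n n ℂ)ᴴ
        (hX.eigenvectorUnitary : Matrix n n ℂ), hU, Matrix.one_mul]
    have hU : (hX.eigenvectorUnitary : Matrix n n ℂ)ᴴ * (hX.eigenvectorUnitary : Matrix n n ℂ)
          = 1 := Unitary.coe_star_mul_self hX.eigenvectorUnitary
    rw [hs, charpoly_mul_comm, ← Matrix.mul_assoc, hU, Matrix.one_mul]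
  have h3 : (diagonal (fun i => ((hX.eigenvalues i ^ 2 : ℝ) : ℂ))).charpoly.roots =
      Multiset.map (fun i => ((hX.eigenvalues i ^ 2 : ℝ) : ℂ)) Finset.univ.val := by
    rw [charpoly_diagonal]
    have h := Polynomial.roots_multiset_prod_X_sub_C
      (Multiset.map (fun i => ((hX.eigenvalues i ^ 2 : ℝ) : ℂ)) Finset.univ.val)
    rwa [Multiset.map_map] at h
  rw [h2, h3] at h1
  have h4 := congrArg (fun s => (Multiset.map (fun z : ℂ => √z.re) s).sum) h1
  simp only [Multiset.map_map, Function.comp_def] at h4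
  have h5 : ∀ x : ℝ, √((x : ℂ).re) = √x := fun x => rfl
  simp only [h5, Real.sqrt_sq_eq_abs] at h4
  exact h4.symm

/-- A quantum channel (completely positive trace preserving map) from `d`- to `e`-dimensional
operators: it preserves the trace, and tensored with the identity on any `k`-dimensional ancilla
it maps positive semidefinite matrices to positive semidefinite matrices. -/
def IsChannel {d e : ℕ} (E : Matrix (Fin d) (Fin d) ℂ →ₗ[ℂ] Matrix (Fin e) (Fin e) ℂ) : Prop :=
  (∀ X, (E X).trace = X.trace) ∧
  ∀ (k : ℕ) (X : Matrix (Fin d × Fin k) (Fin d × Fin k) ℂ), X.PosSemidef →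
    (Matrix.of fun (p q : Fin e × Fin k) =>
      E (Matrix.of fun i j => X (i, p.2) (j, q.2)) p.1 q.1).PosSemidef

/-! ### Haar-random isometries -/

/-- Isometries `ℂⁿ → ℂᵐ`, as matrices. -/
abbrev IsometryMatrix (m n : Type*) [Fintype m] [DecidableEq n] : Type _ :=
  {V : Matrix m n ℂ // Vᴴ * V = 1}

instance (m n : Type*) [Fintype m] [DecidableEq n] : MeasurableSpace (IsometryMatrix m n) :=
  borel _

instance (m n : Type*) [Fintype m] [DecidableEq n] : BorelSpace (IsometryMatrix m n) :=
  ⟨rfl⟩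

instance (m : Type*) [Fintype m] [DecidableEq m] : MeasurableSpace (unitaryGroup m ℂ) :=
  borel _

instance (m : Type*) [Fintype m] [DecidableEq m] : BorelSpace (unitaryGroup m ℂ) :=
  ⟨rfl⟩

instance (m : Type*) [Fintype m] [DecidableEq m] : CompactSpace (unitaryGroup m ℂ) := by
  refine (isCompact_iff_compactSpace (s := (unitaryGroup m ℂ : Set (Matrix m m ℂ)))).mp ?_
  have hK : IsCompact (Set.pi Set.univ (fun _ : m =>
      Set.pi Set.univ (fun _ : m => Metric.closedBall (0 : ℂ) 1))) :=
    isCompact_univ_pi fun _ => isCompact_univ_pi fun _ => isCompact_closedBall _ _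
  refine IsCompact.of_isClosed_subset hK ?_ ?_
  · have : ((unitaryGroup m ℂ : Submonoid (Matrix m m ℂ)) : Set (Matrix m m ℂ)) =
        {U | star U * U = 1} := by
      ext U
      exact mem_unitaryGroup_iff'
    rw [this]
    exact isClosed_eq (by fun_prop) continuous_const
  · intro U hU i _ j _
    simpa using entry_norm_bound_of_unitary hU i j

/-- The Haar probability measure on the unitary group. -/
def haarUnitary (m : Type*) [Fintype m] [DecidableEq m] : Measure (unitaryGroup m ℂ) :=
  Measure.haarMeasure ⊤

instance (m : Type*) [Fintype m] [DecidableEq m] : IsProbabilityMeasure (haarUnitary m) :=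
  ⟨Measure.haarMeasure_self (K₀ := (⊤ : TopologicalSpace.PositiveCompacts (unitaryGroup m ℂ)))⟩

/-- A fixed isometry followed by a unitary. -/
def rotate {m n : Type*} [Fintype m] [DecidableEq m] [DecidableEq n]
    (U : unitaryGroup m ℂ) (V : IsometryMatrix m n) : IsometryMatrix m n :=
  ⟨(U : Matrix m m ℂ) * V.1, by
    have hU : (U : Matrix m m ℂ)ᴴ * (U : Matrix m m ℂ) = 1 := Unitary.coe_star_mul_self U
    rw [conjTranspose_mul, Matrix.mul_assoc, ← Matrix.mul_assoc _ (U : Matrix m m ℂ), hU,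
      Matrix.one_mul, V.2]⟩

theorem continuous_rotate {m n : Type*} [Fintype m] [DecidableEq m] [DecidableEq n]
    (V : IsometryMatrix m n) : Continuous fun U : unitaryGroup m ℂ => rotate U V := by
  unfold rotate
  fun_prop

/-- The uniform (Haar) distribution on isometries: the law of `U * V₀` for a fixed isometry `V₀`
and a Haar-random unitary `U`. -/
def uniformIsometry {m n : Type*} [Fintype m] [DecidableEq m] [DecidableEq n]
    (V₀ : IsometryMatrix m n) : Measure (IsometryMatrix m n) :=
  (haarUnitary m).map fun U => rotate U V₀

instance {m n : Type*} [Fintype m] [DecidableEq m] [DecidableEq n]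
    (V₀ : IsometryMatrix m n) : IsProbabilityMeasure (uniformIsometry V₀) :=
  Measure.isProbabilityMeasure_map (continuous_rotate V₀).measurable.aemeasurable

/-! ### The channel -/

/-- The partial trace over the second tensor factor. -/
def partialTraceRight (a b : Type*) [Fintype b] :
    Matrix (a × b) (a × b) ℂ →ₗ[ℂ] Matrix a a ℂ where
  toFun X := Matrix.of fun i j => ∑ k, X (i, k) (j, k)
  map_add' X Y := by ext i j; simp [Finset.sum_add_distrib]
  map_smul' c X := by ext i j; simp [Finset.mul_sum]

/-- The dimension `⌈d / e⌉` of the subsystem that is traced out. -/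
abbrev anc (d e : ℕ) : ℕ := d ⌈/⌉ e

/-- Isometries `ℂ^d → ℂ^e ⊗ ℂ^⌈d/e⌉`; the tensor product is indexed by pairs of indices. -/
abbrev EmbIsometry (d e : ℕ) : Type :=
  IsometryMatrix (Fin e × Fin (anc d e)) (Fin d)

/-- There are such isometries whenever `e` is positive. -/
theorem nonempty_embIsometry (d e : ℕ) (he : 0 < e) : Nonempty (EmbIsometry d e) := by
  have hle : d ≤ e * anc d e := by
    simpa using le_smul_ceilDiv (α := ℕ) (β := ℕ) (a := e) (b := d) he
  let f : Fin d ↪ Fin e × Fin (anc d e) :=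
    (Fin.castLEEmb hle).trans finProdFinEquiv.symm.toEmbedding
  refine ⟨⟨Matrix.of fun p j => if p = f j then 1 else 0, ?_⟩⟩
  ext i j
  simp [Matrix.mul_apply, Matrix.one_apply, eq_comm, apply_ite]

/-- The channel `𝓔_V`: perform the isometry `V`, then discard the second subsystem. -/
def isometryChannel {d e : ℕ} (V : EmbIsometry d e) :
    Matrix (Fin d) (Fin d) ℂ →ₗ[ℂ] Matrix (Fin e) (Fin e) ℂ :=
  partialTraceRight (Fin e) (Fin (anc d e)) ∘ₗ
    { toFun := fun X => V.1 * X * V.1ᴴ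
      map_add' := fun X Y => by rw [Matrix.mul_add, Matrix.add_mul]
      map_smul' := fun c X => by simp }

/-! ### Quantum embeddings -/

/-- The random map `𝓔 ω`, `ω ∼ μ`, is a quantum embedding of `S` into the `e`-dimensional operators
in the trace norm, with distortion `1 / (1 - ε)` and failure probability `δ`. -/
structure IsQuantumEmbedding {d e : ℕ} (S : Set (Matrix (Fin d) (Fin d) ℂ)) (ε δ : ℝ)
    {Ω : Type*} [MeasurableSpace Ω] (μ : Measure Ω)
    (E : Ω → Matrix (Fin d) (Fin d) ℂ →ₗ[ℂ] Matrix (Fin e) (Fin e) ℂ) : Prop where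
  isProbabilityMeasure : IsProbabilityMeasure μ
  measurable : ∀ X i j, Measurable fun ω => E ω X i j
  isChannel : ∀ ω, IsChannel (E ω)
  preserves : ∀ ρ ∈ S, ∀ σ ∈ S,
    1 - δ ≤ μ.real {ω | (1 - ε) * traceNorm (ρ - σ) ≤ traceNorm (E ω ρ - E ω σ) ∧
      traceNorm (E ω ρ - E ω σ) ≤ traceNorm (ρ - σ)}

/-- The constant `(1 - ln 2) / (2 ln 2) ≈ 0.22`. -/
def K : ℝ := (1 - Real.log 2) / (2 * Real.log 2)

end QEmbed

end

/-!
Let `X = ρ - σ` and let `I` index its positive eigenvectors. There are at most `r = rank ρ` of them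
(`card_pos_eigenvalues_sub_le_rank`). Let `V = U V₀` be the random isometry, `k = ⌈d / e⌉`, and let
`T ⊆ ℂ^e` be the joint support of the reductions to `ℂ^e` of the images of these eigenvectors.
Then `dim T ≤ r k`, so `T ⊗ ℂ^k` has dimension at most `r k²`, which is a small fraction of
`D = e k` when `e² ≥ 4 r d / ε`. All of `V (X⁺) V†` lives on `T ⊗ ℂ^k`. If each of the other
eigenvectors has at most a fraction `ε` of its weight there after applying `V`, then the two-outcome
measurement `{P_T, 1 - P_T}` on `ℂ^e` distinguishes the two outputs well enough for the lower bound
on the trace norm (`le_traceNorm_isometryChannel`).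

For a fixed eigenvector outside `I`, the failure probability is estimated in two steps. By right
invariance of the Haar measure under the unitaries that fix the eigenvectors of `I`, the probability
does not depend on which non-zero vector orthogonal to them is considered, so this vector may be
averaged over a Gaussian measure, with `U` fixed
(`haarUnitary_real_le_of_forall_stdGaussian_real_le`). For fixed `U`, the subspace `T ⊗ ℂ^k` is
fixed too, and the Gaussian mass of the vectors with a fraction more than `ε` of their weight in a
subspace of dimension `q ≤ ε D / 2` is at most `exp (q ln 2 - ε D / 2)`
(`stdGaussian_real_near_complex_submodule_le`, a Chernoff bound). Since `d ≤ D ≤ 2 d`, this is at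
most `exp (-K ε d)` (`exponent_bound`), and a union bound over at most `d` eigenvectors finishes the
estimate. To have measurability for free, the failure event is written as a union of open sets
(`nearSupport`): some point of `T ⊗ ℂ^k` is close to the vector.

For the embedding, `e = ⌈2 √(r d / ε)⌉` works if this is at most `d`. Otherwise `e = d` is already
of order `√(r d)`, and the channel is a unitary conjugation. The upper bound on the trace norm holds
for every `V`, as a channel maps states to states (`traceNorm_isometryChannel_le`).
-/

noncomputable section

namespace QEmbed

open scoped ComplexOrder

/-! ### Trace norm and spectral decomposition -/

section TraceNorm

variable {n ι : Type*} [Fintype n] [DecidableEq n] [Fintype ι]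

theorem conjTranspose_eigenvectorUnitary_mul_mul {H : Matrix n n ℂ} (hH : H.IsHermitian) :
    (hH.eigenvectorUnitary : Matrix n n ℂ)ᴴ * H * (hH.eigenvectorUnitary : Matrix n n ℂ) =
      diagonal (fun i => (hH.eigenvalues i : ℂ)) := by
  have h := hH.conjStarAlgAut_star_eigenvectorUnitary
  rw [Unitary.conjStarAlgAut_star_apply] at h
  exact h

theorem eq_sum_eigenvalues_smul {H : Matrix n n ℂ} (hH : H.IsHermitian) :
    H = ∑ i, (hH.eigenvalues i : ℂ) •
      vecMulVec ((hH.eigenvectorUnitary : Matrix n n ℂ).col i)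
        (star ((hH.eigenvectorUnitary : Matrix n n ℂ).col i)) := by
  have h := hH.spectral_theorem
  rw [Unitary.conjStarAlgAut_apply, star_eq_conjTranspose] at h
  conv_lhs => rw [h]
  ext a b
  rw [Matrix.mul_apply, Matrix.sum_apply]
  refine Finset.sum_congr rfl fun i _ => ?_
  have hcoe : (RCLike.ofReal (hH.eigenvalues i) : ℂ) = Complex.ofReal (hH.eigenvalues i) := rfl
  rw [mul_diagonal, conjTranspose_apply, Matrix.smul_apply, vecMulVec_apply, Pi.star_apply,
    col_apply, col_apply, smul_eq_mul, Function.comp_apply,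
    hcoe]
  ring

/-- The trace norm dominates the pairing with every reflection-like operator `2P - 1`,
`0 ≤ P ≤ 1`. -/
theorem two_mul_trace_sub_trace_le_traceNorm {H P : Matrix n n ℂ} (hH : H.IsHermitian)
    (hP : P.PosSemidef) (hP' : (1 - P).PosSemidef) :
    2 * (P * H).trace.re - H.trace.re ≤ traceNorm H := by
  rw [traceNorm_eq_sum_abs_eigenvalues hH]
  set W := (hH.eigenvectorUnitary : Matrix n n ℂ)
  have hW : W * Wᴴ = 1 := Unitary.coe_mul_star_self hH.eigenvectorUnitary
  have hW' : Wᴴ * W = 1 := Unitary.coe_star_mul_self hH.eigenvectorUnitary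
  have key : ∀ X : Matrix n n ℂ,
      (X * H).trace.re = ∑ i, ((Wᴴ * X * W) i i).re * hH.eigenvalues i := by
    intro X
    have h1 : (X * H).trace = ((Wᴴ * X * W) * (Wᴴ * H * W)).trace := by
      have : (Wᴴ * X * W) * (Wᴴ * H * W) = Wᴴ * (X * H * W) := by
        simp only [Matrix.mul_assoc]
        rw [← Matrix.mul_assoc W Wᴴ, hW, Matrix.one_mul]
      rw [this, trace_mul_comm Wᴴ, Matrix.mul_assoc (X * H), hW, Matrix.mul_one]
    rw [h1, conjTranspose_eigenvectorUnitary_mul_mul hH]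
    simp [Matrix.trace, mul_diagonal]
  have h3 := key 1
  rw [Matrix.one_mul, Matrix.mul_one, hW'] at h3
  rw [key P, h3, Finset.mul_sum, ← Finset.sum_sub_distrib]
  refine Finset.sum_le_sum fun i _ => ?_
  have h1i := (Complex.le_def.1 ((hP.conjTranspose_mul_mul_same W).diag_nonneg (i := i))).1
  have h2i := (Complex.le_def.1 ((hP'.conjTranspose_mul_mul_same W).diag_nonneg (i := i))).1
  rw [Matrix.mul_sub, Matrix.sub_mul, Matrix.mul_one, hW'] at h2i
  simp only [Matrix.sub_apply, one_apply_eq, Complex.sub_re, Complex.one_re,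
    Complex.zero_re] at h1i h2i
  simp only [one_apply_eq, Complex.one_re]
  rcases abs_cases (hH.eigenvalues i) with ⟨h, h'⟩ | ⟨h, h'⟩ <;> rw [h] <;> nlinarith

/-- A real combination of states has trace norm at most the `ℓ¹` norm of its coefficients. -/
theorem traceNorm_le_sum_abs {H : Matrix n n ℂ} (hH : H.IsHermitian) (c : ι → ℝ)
    (A : ι → Matrix n n ℂ) (hA : ∀ i, IsState (A i)) (h : H = ∑ i, (c i : ℂ) • A i) :
    traceNorm H ≤ ∑ i, |c i| := by
  rw [traceNorm_eq_sum_abs_eigenvalues hH]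
  set W := (hH.eigenvectorUnitary : Matrix n n ℂ)
  have hW : W * Wᴴ = 1 := Unitary.coe_mul_star_self hH.eigenvectorUnitary
  have h1 : ∀ j, hH.eigenvalues j = ∑ i, c i * ((Wᴴ * A i * W) j j).re := by
    intro j
    have := congrArg (fun X => (X j j).re) (conjTranspose_eigenvectorUnitary_mul_mul hH)
    simp only [diagonal_apply_eq, Complex.ofReal_re] at this
    have h' : Wᴴ * H * W = ∑ i, (c i : ℂ) • (Wᴴ * A i * W) := by
      rw [congrArg (fun X => Wᴴ * X * W) h]
      simp only [Matrix.mul_sum, Matrix.sum_mul, Matrix.mul_smul, Matrix.smul_mul]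
    rw [← this, h']
    simp [Matrix.sum_apply]
  have h2 : ∀ i j, 0 ≤ ((Wᴴ * A i * W) j j).re := fun i j =>
    (Complex.le_def.1 (((hA i).1.conjTranspose_mul_mul_same W).diag_nonneg (i := j))).1
  have h3 : ∀ i, ∑ j, ((Wᴴ * A i * W) j j).re = 1 := by
    intro i
    have : (Wᴴ * A i * W).trace = 1 := by
      rw [Matrix.mul_assoc, trace_mul_comm, Matrix.mul_assoc, hW, Matrix.mul_one, (hA i).2]
    simpa [Matrix.trace] using congrArg Complex.re this
  calc ∑ j, |hH.eigenvalues j| ≤ ∑ j, ∑ i, |c i| * ((Wᴴ * A i * W) j j).re := by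
        refine Finset.sum_le_sum fun j _ => ?_
        rw [h1 j]
        refine (Finset.abs_sum_le_sum_abs _ _).trans (Finset.sum_le_sum fun i _ => ?_)
        rw [abs_mul, abs_of_nonneg (h2 i j)]
    _ = ∑ i, |c i| := by
        rw [Finset.sum_comm]
        exact Finset.sum_congr rfl fun i _ => by rw [← Finset.mul_sum, h3, mul_one]

/-- The trace norm is unitarily invariant. -/
theorem traceNorm_mul_mul_conjTranspose {W : Matrix n n ℂ} (h : Wᴴ * W = 1)
    (X : Matrix n n ℂ) : traceNorm (W * X * Wᴴ) = traceNorm X := by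
  have h1 : ((W * X * Wᴴ)ᴴ * (W * X * Wᴴ)).charpoly = (Xᴴ * X).charpoly := by
    have : (W * X * Wᴴ)ᴴ * (W * X * Wᴴ) = W * (Xᴴ * X * Wᴴ) := by
      simp only [conjTranspose_mul, conjTranspose_conjTranspose, Matrix.mul_assoc]
      rw [← Matrix.mul_assoc Wᴴ W, h, Matrix.one_mul]
    rw [this, charpoly_mul_comm, Matrix.mul_assoc, h, Matrix.mul_one]
  unfold traceNorm
  rw [(IsHermitian.eigenvalues_eq_eigenvalues_iff _ _).2 h1]

/-- There is an orthogonal projection `P` onto the range of `M`: the last two conditions say that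
its range contains, and is contained in, the range of `M`. -/
theorem exists_rangeProjection {m : Type*} [Fintype m] (M : Matrix n m ℂ) :
    ∃ (P : Matrix n n ℂ) (N : Matrix m n ℂ), Pᴴ = P ∧ P * P = P ∧ P * M = M ∧ P = M * N := by
  have hH := isHermitian_mul_conjTranspose_self M
  set W := (hH.eigenvectorUnitary : Matrix n n ℂ) with hWdef
  have hW : W * Wᴴ = 1 := Unitary.coe_mul_star_self hH.eigenvectorUnitary
  have hW' : Wᴴ * W = 1 := Unitary.coe_star_mul_self hH.eigenvectorUnitary
  have hdiag := conjTranspose_eigenvectorUnitary_mul_mul hH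
  set D : Matrix n n ℂ := diagonal (fun i => (hH.eigenvalues i : ℂ))
  -- The pseudo-inverse of `D`, thanks to `0⁻¹ = 0`.
  let J : Matrix n n ℂ := diagonal (fun i => ((hH.eigenvalues i)⁻¹ : ℂ))
  have hMM : M * Mᴴ = W * D * Wᴴ := by
    rw [← hdiag]
    simp only [← hWdef, Matrix.mul_assoc, hW, Matrix.mul_one]
    rw [← Matrix.mul_assoc W Wᴴ, hW, Matrix.one_mul]
  have hDJ : D * J * (D * J) = D * J := by
    simp only [D, J, diagonal_mul_diagonal]
    congr 1; funext i
    by_cases h : (hH.eigenvalues i : ℂ) = 0 <;> simp [h]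
  have hDJh : (D * J)ᴴ = D * J := by
    simp only [D, J, diagonal_mul_diagonal, diagonal_conjTranspose]
    congr 1; funext i
    simp
  have hDJD : D * J * D = D := by
    simp only [D, J, diagonal_mul_diagonal]
    congr 1; funext i
    by_cases h : (hH.eigenvalues i : ℂ) = 0 <;> simp [h]
  have hP : M * (Mᴴ * W * J * Wᴴ) = W * (D * J) * Wᴴ := by
    simp only [← Matrix.mul_assoc]
    rw [hMM]
    simp only [Matrix.mul_assoc]
    rw [← Matrix.mul_assoc Wᴴ W, hW', Matrix.one_mul]
  have hcancel : ∀ X Y : Matrix n n ℂ, W * X * Wᴴ * (W * Y * Wᴴ) = W * (X * Y) * Wᴴ := by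
    intro X Y
    simp only [Matrix.mul_assoc]
    rw [← Matrix.mul_assoc Wᴴ W, hW', Matrix.one_mul]
  set P := W * (D * J) * Wᴴ
  have hPh : Pᴴ = P := by
    simp only [P, conjTranspose_mul, conjTranspose_conjTranspose, ← Matrix.mul_assoc]
    rw [Matrix.mul_assoc W, ← conjTranspose_mul, hDJh, ← Matrix.mul_assoc]
  refine ⟨P, Mᴴ * W * J * Wᴴ, hPh, ?_, ?_, hP.symm⟩
  · rw [hcancel, hDJ]
  · have h0 : (P - 1) * M * ((P - 1) * M)ᴴ = 0 := by
      have : (P - 1) * (M * Mᴴ) = 0 := by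
        rw [Matrix.sub_mul, Matrix.one_mul, hMM, hcancel, hDJD, sub_self]
      rw [conjTranspose_mul, ← Matrix.mul_assoc, Matrix.mul_assoc (P - 1), this, Matrix.zero_mul]
    have := Matrix.self_mul_conjTranspose_eq_zero.1 h0
    rwa [Matrix.sub_mul, Matrix.one_mul, sub_eq_zero] at this

/-- A positive eigenvector of `ρ - σ` cannot be killed by `ρ`, so `ρ - σ` has at most `rank ρ`
positive eigenvalues. -/
theorem card_pos_eigenvalues_sub_le_rank {ρ σ : Matrix n n ℂ} (hσ : σ.PosSemidef)
    (hH : (ρ - σ).IsHermitian) : Fintype.card {i // 0 < hH.eigenvalues i} ≤ ρ.rank := by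
  classical
  set W := (hH.eigenvectorUnitary : Matrix n n ℂ)
  let B : Matrix n {i // 0 < hH.eigenvalues i} ℂ := W.submatrix id Subtype.val
  have hd : Bᴴ * (ρ - σ) * B = diagonal (fun i => (hH.eigenvalues i.1 : ℂ)) := by
    have : Bᴴ * (ρ - σ) * B = (Wᴴ * (ρ - σ) * W).submatrix Subtype.val Subtype.val := by
      ext i j; simp [B, Matrix.mul_apply, W]
    rw [this, conjTranspose_eigenvectorUnitary_mul_mul hH]
    ext i j
    simp [diagonal_apply, Subtype.ext_iff]
  have hpd : (Bᴴ * ρ * B).PosDef := by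
    have : Bᴴ * ρ * B = diagonal (fun i => (hH.eigenvalues i.1 : ℂ)) + Bᴴ * σ * B := by
      rw [← hd, Matrix.mul_sub, Matrix.sub_mul, sub_add_cancel]
    rw [this]
    refine PosDef.add_posSemidef (PosDef.diagonal fun i => ?_) (hσ.conjTranspose_mul_mul_same B)
    exact_mod_cast i.2
  calc Fintype.card {i // 0 < hH.eigenvalues i} = (Bᴴ * ρ * B).rank :=
        (rank_of_isUnit _ hpd.isUnit).symm
    _ ≤ (Bᴴ * ρ).rank := rank_mul_le_left _ _
    _ ≤ ρ.rank := rank_mul_le_right _ _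

end TraceNorm

/-! ### Gaussian concentration -/

open ProbabilityTheory in
theorem integrable_and_integral_exp_mul_sq {s : ℝ} (hs : s < 1 / 2) :
    Integrable (fun x => Real.exp (s * x ^ 2)) (gaussianReal 0 1) ∧
      ∫ x, Real.exp (s * x ^ 2) ∂gaussianReal 0 1 = (√(1 - 2 * s))⁻¹ := by
  have hpdf : ∀ x : ℝ, gaussianPDFReal 0 1 x * Real.exp (s * x ^ 2) =
      (√(2 * Real.pi))⁻¹ * Real.exp (-(1 / 2 - s) * x ^ 2) := by
    intro x
    simp only [gaussianPDFReal, NNReal.coe_one, mul_one, sub_zero]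
    rw [mul_assoc, ← Real.exp_add]
    congr 2
    ring
  constructor
  · rw [gaussianReal_of_var_ne_zero _ one_ne_zero,
      integrable_withDensity_iff_integrable_smul₀' (by fun_prop) (by simp [gaussianPDF])]
    simp only [toReal_gaussianPDF, smul_eq_mul, hpdf]
    exact (integrable_exp_neg_mul_sq (by linarith)).const_mul _
  · rw [integral_gaussianReal_eq_integral_smul one_ne_zero]
    simp only [smul_eq_mul, hpdf]
    rw [integral_const_mul, integral_gaussian, ← Real.sqrt_inv, ← Real.sqrt_inv,
      ← Real.sqrt_mul (by positivity)]
    congr 1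
    have : (1 / 2 - s) ≠ 0 := by linarith
    have : (1 - 2 * s) ≠ 0 := by linarith
    field_simp

open ProbabilityTheory in
/-- Chernoff bound for the Gaussian mass of the vectors close to a fixed subspace, in terms of an
orthonormal basis whose second part is orthogonal to the subspace. -/
theorem stdGaussian_real_near_submodule_le_of_basis {E : Type*} [NormedAddCommGroup E]
    [InnerProductSpace ℝ E] [FiniteDimensional ℝ E] [MeasurableSpace E] [BorelSpace E]
    (R : Submodule ℝ E) {ε : ℝ} (hε₀ : 0 < ε) (hε₁ : ε < 1) {p q : ℕ}
    (b : OrthonormalBasis (Fin p ⊕ Fin q) ℝ E) (hb : ∀ i, b (Sum.inr i) ∈ Rᗮ) :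
    (stdGaussian E).real {g | ∃ u ∈ R, ‖g - u‖ ^ 2 < (1 - ε) * ‖g‖ ^ 2} ≤
      √2 ^ p * √((1 - ε) / (1 - ε / 2)) ^ q := by
  let F : (Fin p ⊕ Fin q → ℝ) → E := fun x => ∑ i, x i • b i
  have hF : Measurable F := by fun_prop
  have hε : 0 < 1 - ε := by linarith
  -- Weights of the Chernoff functional `exp (∑ cᵢ xᵢ²)`, which is at least `1` on the event. Any
  -- positive multiple of `(1 - ε, -ε)` has this property; with `1 / 4` along `R`, each dimension of
  -- `R` costs a factor `√2`.
  let c : Fin p ⊕ Fin q → ℝ := Sum.elim (fun _ => 1 / 4) (fun _ => -(ε / (4 * (1 - ε))))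
  have hc : ∀ i, c i < 1 / 2 := by
    rintro (i | i)
    · norm_num [c]
    · have : 0 < ε / (4 * (1 - ε)) := by positivity
      simp only [c, Sum.elim_inr]; linarith
  have hinner : ∀ y i, inner ℝ (b i) (F y) = y i := fun y i =>
    b.orthonormal.inner_right_fintype y i
  have hsub : F ⁻¹' {g | ∃ u ∈ R, ‖g - u‖ ^ 2 < (1 - ε) * ‖g‖ ^ 2} ⊆
      {x | (1 : ℝ) ≤ ∏ i, Real.exp (c i * x i ^ 2)} := by
    rintro x ⟨u, hu, hlt⟩
    rw [← b.sum_sq_inner_right (F x), ← b.sum_sq_inner_right (F x - u)] at hlt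
    simp only [inner_sub_right, hinner, Fintype.sum_sum_type,
      fun i => Submodule.inner_left_of_mem_orthogonal hu (hb i), sub_zero] at hlt
    have h0 : 0 ≤ ∑ i, (x (Sum.inl i) - inner ℝ (b (Sum.inl i)) u) ^ 2 :=
      Finset.sum_nonneg fun i _ => sq_nonneg _
    simp only [Set.mem_ofPred_eq, ← Real.exp_sum, Real.one_le_exp_iff, Fintype.sum_sum_type, c,
      Sum.elim_inl, Sum.elim_inr, ← Finset.mul_sum]
    have h1 : 1 / 4 * ∑ i, x (Sum.inl i) ^ 2 + -(ε / (4 * (1 - ε))) * ∑ i, x (Sum.inr i) ^ 2 =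
        ((1 - ε) * ∑ i, x (Sum.inl i) ^ 2 - ε * ∑ i, x (Sum.inr i) ^ 2) / (4 * (1 - ε)) := by
      field_simp
      ring
    rw [h1]
    exact div_nonneg (by linarith) (by linarith)
  have hint : Integrable (fun x : Fin p ⊕ Fin q → ℝ => ∏ i, Real.exp (c i * x i ^ 2))
      (Measure.pi fun _ => gaussianReal 0 1) :=
    Integrable.fintype_prod fun i => (integrable_and_integral_exp_mul_sq (hc i)).1
  have hmarkov := mul_meas_ge_le_integral_of_nonneg
    (Filter.Eventually.of_forall fun x => Finset.prod_nonneg fun i _ => (Real.exp_pos _).le)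
    hint 1
  rw [one_mul, integral_fintype_prod_eq_prod (f := fun i x => Real.exp (c i * x ^ 2)),
    Fintype.prod_sum_type] at hmarkov
  simp only [fun i => (integrable_and_integral_exp_mul_sq (hc i)).2] at hmarkov
  have hmeas : MeasurableSet {g : E | ∃ u ∈ R, ‖g - u‖ ^ 2 < (1 - ε) * ‖g‖ ^ 2} := by
    have : {g : E | ∃ u ∈ R, ‖g - u‖ ^ 2 < (1 - ε) * ‖g‖ ^ 2} =
        ⋃ u ∈ R, {g | ‖g - u‖ ^ 2 < (1 - ε) * ‖g‖ ^ 2} := by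
      ext; simp
    rw [this]
    exact (isOpen_biUnion fun u _ => isOpen_lt (by fun_prop) (by fun_prop)).measurableSet
  rw [stdGaussian_eq_map_pi_orthonormalBasis b, map_measureReal_apply hF hmeas]
  refine (measureReal_mono hsub).trans (hmarkov.trans_eq ?_)
  have e1 : (√(1 - 2 * (1 / 4) : ℝ))⁻¹ = √2 := by
    rw [← Real.sqrt_inv]; norm_num
  have e2 : (√(1 - 2 * -(ε / (4 * (1 - ε)))))⁻¹ = √((1 - ε) / (1 - ε / 2)) := by
    rw [← Real.sqrt_inv]
    congr 1
    have : 1 - ε / 2 ≠ 0 := by linarith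
    have : 1 - 2 * -(ε / (4 * (1 - ε))) = (1 - ε / 2) / (1 - ε) := by
      field_simp; ring
    rw [this, inv_div]
  simp only [c, Sum.elim_inl, Sum.elim_inr, e1, e2, Finset.prod_const, Finset.card_univ,
    Fintype.card_fin]

open ProbabilityTheory in
theorem stdGaussian_real_near_submodule_le {E : Type*} [NormedAddCommGroup E]
    [InnerProductSpace ℝ E] [FiniteDimensional ℝ E] [MeasurableSpace E] [BorelSpace E]
    (R : Submodule ℝ E) {ε : ℝ} (hε₀ : 0 < ε) (hε₁ : ε < 1) :
    (stdGaussian E).real {g | ∃ u ∈ R, ‖g - u‖ ^ 2 < (1 - ε) * ‖g‖ ^ 2} ≤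
      √2 ^ Module.finrank ℝ R * √((1 - ε) / (1 - ε / 2)) ^ Module.finrank ℝ Rᗮ :=
  stdGaussian_real_near_submodule_le_of_basis R hε₀ hε₁
    (((stdOrthonormalBasis ℝ R).prod (stdOrthonormalBasis ℝ Rᗮ)).map
      R.orthogonalDecomposition.symm) fun i => by simp

open ProbabilityTheory in
/-- For a complex subspace of dimension at most `q ≤ ε D / 2` in `D` dimensions, the Gaussian mass
of the vectors close to it is exponentially small. -/
theorem stdGaussian_real_near_complex_submodule_le {m : Type*} [Fintype m]
    (R : Submodule ℂ (EuclideanSpace ℂ m)) {ε : ℝ} (hε₀ : 0 < ε) (hε₁ : ε < 1) {q : ℕ}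
    (hR : Module.finrank ℂ R ≤ q) (hq : (q : ℝ) ≤ ε / 2 * Fintype.card m) :
    (stdGaussian (EuclideanSpace ℂ m)).real
        {g | ∃ u ∈ R, ‖g - u‖ ^ 2 < (1 - ε) * ‖g‖ ^ 2} ≤
      Real.exp (q * Real.log 2 - ε / 2 * Fintype.card m) := by
  set p := Module.finrank ℂ R
  have hp : Module.finrank ℝ (R.restrictScalars ℝ) = 2 * p := finrank_real_of_complex R
  have hE : Module.finrank ℝ (EuclideanSpace ℂ m) = 2 * Fintype.card m := by
    rw [finrank_real_of_complex, finrank_euclideanSpace]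
  have hsum := (R.restrictScalars ℝ).finrank_add_finrank_orthogonal
  have hperp : Module.finrank ℝ (R.restrictScalars ℝ)ᗮ = 2 * (Fintype.card m - p) := by omega
  have hle : p ≤ Fintype.card m := by omega
  refine (stdGaussian_real_near_submodule_le (R.restrictScalars ℝ) hε₀ hε₁).trans ?_
  have hε : 0 < 1 - ε := by linarith
  have hε2 : 0 < 1 - ε / 2 := by linarith
  rw [hp, hperp, pow_mul, pow_mul, Real.sq_sqrt (by norm_num), Real.sq_sqrt (by positivity)]
  have h2 : (2 : ℝ) ^ p = Real.exp (p * Real.log 2) := by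
    rw [Real.exp_nat_mul, Real.exp_log (by norm_num)]
  have hc : (1 - ε) / (1 - ε / 2) ≤ Real.exp (-(ε / 2 / (1 - ε / 2))) := by
    have : (1 - ε) / (1 - ε / 2) = -(ε / 2 / (1 - ε / 2)) + 1 := by
      rw [← neg_div, div_add' _ _ _ hε2.ne']
      ring_nf
    rw [this]
    exact Real.add_one_le_exp _
  have hpq : (p : ℝ) ≤ q := by exact_mod_cast hR
  calc (2 : ℝ) ^ p * ((1 - ε) / (1 - ε / 2)) ^ (Fintype.card m - p)
      ≤ Real.exp (p * Real.log 2) *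
        Real.exp (-(ε / 2 / (1 - ε / 2))) ^ (Fintype.card m - p) := by
        rw [h2]; gcongr
    _ = Real.exp (p * Real.log 2 - (Fintype.card m - p) * (ε / 2 / (1 - ε / 2))) := by
        rw [← Real.exp_nat_mul, ← Real.exp_add, Nat.cast_sub hle]
        ring_nf
    _ ≤ _ := by
        refine Real.exp_le_exp.2 (sub_le_sub ?_ ?_)
        · exact mul_le_mul_of_nonneg_right hpq (Real.log_nonneg (by norm_num))
        · rw [mul_div_assoc', le_div_iff₀ hε2]
          nlinarith

/-! ### Haar measure -/

section Haar

variable {m I : Type*} [Fintype m]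

theorem star_dotProduct_self_eq_norm_sq (y : EuclideanSpace ℂ m) :
    star y.ofLp ⬝ᵥ y.ofLp = ((‖y‖ ^ 2 : ℝ) : ℂ) := by
  rw [dotProduct_comm, ← EuclideanSpace.inner_eq_star_dotProduct, inner_self_eq_norm_sq_to_K]
  norm_cast

variable [DecidableEq m]

instance : (haarUnitary m).IsHaarMeasure := by
  unfold haarUnitary; infer_instance

/-- The Haar measure on the compact group of unitaries is also right invariant. -/
theorem haarUnitary_map_mul_right (W : unitaryGroup m ℂ) :
    (haarUnitary m).map (· * W) = haarUnitary m := by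
  have hc : Continuous fun U : unitaryGroup m ℂ => U * W := continuous_mul_const W
  have : IsProbabilityMeasure ((haarUnitary m).map (· * W)) :=
    Measure.isProbabilityMeasure_map hc.measurable.aemeasurable
  exact Measure.isHaarMeasure_eq_of_isProbabilityMeasure _ _

/-- A complex Householder reflection, taking `x` to `y` and fixing everything orthogonal to
both. -/
theorem exists_unitary_mulVec_eq {x y : m → ℂ} (hxy : star x ⬝ᵥ x = star y ⬝ᵥ y)
    (A : Matrix m I ℂ) (hx : Aᴴ *ᵥ x = 0) (hy : Aᴴ *ᵥ y = 0) :
    ∃ W : unitaryGroup m ℂ, (W : Matrix m m ℂ) *ᵥ x = y ∧ (W : Matrix m m ℂ) * A = A := by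
  set a := x - y with ha
  by_cases h0 : a = 0
  · exact ⟨1, by simpa using sub_eq_zero.1 (ha.symm.trans h0), by simp⟩
  set s := star a ⬝ᵥ x with hs
  have hss : s + star s = star a ⬝ᵥ a := by
    have h1 : star s = star x ⬝ᵥ a := by rw [hs, star_dotProduct, star_star]
    rw [h1, hs, ha]
    simp only [star_sub, sub_dotProduct, dotProduct_sub]
    linear_combination hxy
  have hs0 : s ≠ 0 := by
    intro h
    rw [h, star_zero, add_zero] at hss
    exact h0 (dotProduct_star_self_eq_zero.1 hss.symm)
  have hs0' : star s ≠ 0 := star_ne_zero.2 hs0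
  -- The factor `s⁻¹` instead of the usual `2 / ‖a‖²` makes this work when `⟪x, y⟫` is not real;
  -- the two agree when it is.
  set W : Matrix m m ℂ := 1 - s⁻¹ • vecMulVec a (star a) with hW
  have hWU : star W * W = 1 := by
    have h1 : star W = 1 - (star s)⁻¹ • vecMulVec a (star a) := by
      rw [hW, star_eq_conjTranspose, conjTranspose_sub, conjTranspose_one, conjTranspose_smul,
        conjTranspose_vecMulVec, star_star, star_inv₀]
    have h2 : vecMulVec a (star a) * vecMulVec a (star a) =
        (s + star s) • vecMulVec a (star a) := by
      rw [vecMulVec_mul_vecMulVec, hss, vecMulVec_smul]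
    rw [h1, hW, Matrix.sub_mul, Matrix.one_mul, Matrix.mul_sub, Matrix.mul_one, Matrix.smul_mul,
      Matrix.mul_smul, h2]
    set E := vecMulVec a (star a)
    have h3 : 1 - s⁻¹ • E - ((star s)⁻¹ • E - (star s)⁻¹ • s⁻¹ • (s + star s) • E) =
        1 - (s⁻¹ + (star s)⁻¹ - (star s)⁻¹ * s⁻¹ * (s + star s)) • E := by
      module
    have h4 : s⁻¹ + (star s)⁻¹ - (star s)⁻¹ * s⁻¹ * (s + star s) = 0 := by
      field_simp
      ring
    rw [h3, h4, zero_smul, sub_zero]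
  refine ⟨⟨W, mem_unitaryGroup_iff'.2 hWU⟩, ?_, ?_⟩
  · change W *ᵥ x = y
    rw [hW, sub_mulVec, one_mulVec, smul_mulVec, vecMulVec_mulVec, ← hs]
    ext i
    simp [ha, hs0]
  · change W * A = A
    have : star a ᵥ* A = 0 := by
      have : Aᴴ *ᵥ a = 0 := by rw [ha, mulVec_sub, hx, hy, sub_zero]
      have := congrArg star this
      rwa [star_mulVec, conjTranspose_conjTranspose, star_zero] at this
    rw [hW, Matrix.sub_mul, Matrix.one_mul, Matrix.smul_mul, vecMulVec_mul, this]
    ext i j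
    simp [vecMulVec_apply]

open ProbabilityTheory in
theorem stdGaussian_inner_eq_zero {E : Type*} [NormedAddCommGroup E]
    [InnerProductSpace ℝ E] [FiniteDimensional ℝ E] [MeasurableSpace E] [BorelSpace E]
    {x : E} (hx : x ≠ 0) : stdGaussian E {g | inner ℝ x g = 0} = 0 := by
  have h := IsGaussian.map_eq_gaussianReal (μ := stdGaussian E) (innerSL ℝ x)
  have hv : Var[innerSL ℝ x; stdGaussian E] = ‖x‖ ^ 2 := by
    rw [variance_dual_stdGaussian, innerSL_apply_norm]
  have hne : Real.toNNReal (Var[innerSL ℝ x; stdGaussian E]) ≠ 0 := by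
    rw [hv]; simpa using hx
  have : NullSingletonClass (gaussianReal (stdGaussian E)[innerSL ℝ x]
    (Var[innerSL ℝ x; stdGaussian E]).toNNReal) := nullSingletonClass_gaussianReal hne
  have h2 := Measure.map_apply (μ := stdGaussian E) (f := innerSL ℝ x) (by fun_prop)
    (measurableSet_singleton (0 : ℝ))
  rw [h, measure_singleton] at h2
  exact h2.symm

open ProbabilityTheory in
/-- An event that depends on a Haar-random unitary `U` and on a direction `x` orthogonal to the
columns of `A`, and that is invariant under replacing `U` by `U W` when `W` fixes these columns,
has a probability that does not depend on `x`. The direction can therefore be averaged over a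
Gaussian measure, for each value of `U` separately. -/
theorem haarUnitary_real_le_of_forall_stdGaussian_real_le [Fintype I] [DecidableEq I]
    (A : Matrix m I ℂ) (hA : Aᴴ * A = 1)
    {B : Set (unitaryGroup m ℂ × EuclideanSpace ℂ m)} (hB : IsOpen B)
    (hsmul : ∀ U x (c : ℂ), c ≠ 0 → (U, x) ∈ B → (U, c • x) ∈ B)
    (hinv : ∀ (U W : unitaryGroup m ℂ) (x : EuclideanSpace ℂ m), (W : Matrix m m ℂ) * A = A →
      (U * W, x) ∈ B → (U, WithLp.toLp 2 ((W : Matrix m m ℂ) *ᵥ x.ofLp)) ∈ B)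
    {δ : ℝ} (hδ : ∀ U, (stdGaussian (EuclideanSpace ℂ m)).real
      {g | (U, g - WithLp.toLp 2 (A *ᵥ (Aᴴ *ᵥ g.ofLp))) ∈ B} ≤ δ)
    {x : EuclideanSpace ℂ m} (hx : x ≠ 0) (hAx : Aᴴ *ᵥ x.ofLp = 0) :
    (haarUnitary m).real {U | (U, x) ∈ B} ≤ δ := by
  set γ := stdGaussian (EuclideanSpace ℂ m)
  let T : EuclideanSpace ℂ m → EuclideanSpace ℂ m := fun g =>
    g - WithLp.toLp 2 (A *ᵥ (Aᴴ *ᵥ g.ofLp))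
  have hT : Continuous T := by fun_prop
  have hf : ∀ y : EuclideanSpace ℂ m, y ≠ 0 → Aᴴ *ᵥ y.ofLp = 0 →
      haarUnitary m {U | (U, x) ∈ B} ≤ haarUnitary m {U | (U, y) ∈ B} := by
    intro y hy hAy
    have hny : ‖y‖ ≠ 0 := norm_ne_zero_iff.2 hy
    have hnx : ‖x‖ ≠ 0 := norm_ne_zero_iff.2 hx
    set c : ℂ := ((‖x‖ / ‖y‖ : ℝ) : ℂ) with hc
    have hc0 : c ≠ 0 := by rw [hc]; exact_mod_cast div_ne_zero hnx hny
    have hnorm : ‖c • y‖ = ‖x‖ := by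
      rw [norm_smul, hc, Complex.norm_real, Real.norm_of_nonneg (by positivity)]
      field_simp
    obtain ⟨W, hWx, hWA⟩ := exists_unitary_mulVec_eq (x := x.ofLp) (y := (c • y).ofLp)
      (by rw [star_dotProduct_self_eq_norm_sq, star_dotProduct_self_eq_norm_sq, hnorm]) A hAx
      (by simp [mulVec_smul, hAy])
    have hmeas : MeasurableSet {U : unitaryGroup m ℂ | (U, x) ∈ B} :=
      (hB.preimage (Continuous.prodMk_left x)).measurableSet
    calc haarUnitary m {U | (U, x) ∈ B}
        = haarUnitary m {U | (U * W, x) ∈ B} := by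
          conv_lhs => rw [← haarUnitary_map_mul_right W]
          rw [Measure.map_apply (continuous_mul_const W).measurable hmeas]
          rfl
      _ ≤ haarUnitary m {U | (U, y) ∈ B} := by
          refine measure_mono fun U hU => ?_
          have h1 := hinv U W x hWA hU
          rw [hWx] at h1
          have h2 := hsmul U _ c⁻¹ (inv_ne_zero hc0) h1
          simpa [smul_smul, hc0] using h2
  -- `T g = 0` forces `g ⟂ x`, since `x` is orthogonal to the columns of `A`.
  have hae : ∀ᵐ g ∂γ, T g ≠ 0 := by
    rw [ae_iff]
    refine measure_mono_null (fun g hg => ?_) (stdGaussian_inner_eq_zero hx)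
    have hg' : g = WithLp.toLp 2 (A *ᵥ (Aᴴ *ᵥ g.ofLp)) := sub_eq_zero.1 (not_not.1 hg)
    have h0 : inner ℂ x g = 0 := by
      rw [EuclideanSpace.inner_eq_star_dotProduct, dotProduct_comm, congrArg WithLp.ofLp hg',
        dotProduct_mulVec]
      have : star x.ofLp ᵥ* A = 0 := by
        have := congrArg star hAx
        rwa [star_mulVec, conjTranspose_conjTranspose, star_zero] at this
      rw [this, zero_dotProduct]
    change inner ℝ x g = 0
    have h1 : inner ℝ x g = (inner ℂ x g : ℂ).re := by
      simp [PiLp.inner_apply]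
    rw [h1, h0, Complex.zero_re]
  have hAT : ∀ g, Aᴴ *ᵥ (T g).ofLp = 0 := by
    intro g
    simp [T, mulVec_sub, mulVec_mulVec, ← Matrix.mul_assoc, hA]
  have hle : haarUnitary m {U | (U, x) ∈ B} ≤ ENNReal.ofReal δ := by
    have hS : MeasurableSet (Prod.map id T ⁻¹' B : Set (unitaryGroup m ℂ × EuclideanSpace ℂ m)) :=
      (hB.preimage (continuous_id.prodMap hT)).measurableSet
    calc haarUnitary m {U | (U, x) ∈ B} = ∫⁻ _, haarUnitary m {U | (U, x) ∈ B} ∂γ := by simp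
      _ ≤ ∫⁻ g, haarUnitary m {U | (U, T g) ∈ B} ∂γ :=
          lintegral_mono_ae (hae.mono fun g hg => hf _ hg (hAT g))
      _ = ((haarUnitary m).prod γ) (Prod.map id T ⁻¹' B) :=
          (Measure.prod_apply_symm hS).symm
      _ = ∫⁻ U, γ {g | (U, T g) ∈ B} ∂haarUnitary m := Measure.prod_apply hS
      _ ≤ ∫⁻ _, ENNReal.ofReal δ ∂haarUnitary m := by
          refine lintegral_mono fun U => ?_
          rw [← ofReal_measureReal (measure_ne_top γ _)]
          exact ENNReal.ofReal_le_ofReal (hδ U)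
      _ = ENNReal.ofReal δ := by simp
  have hδ0 : 0 ≤ δ := measureReal_nonneg.trans (hδ 1)
  exact ENNReal.toReal_le_of_le_ofReal hδ0 hle

end Haar

/-! ### The channel of an isometry -/

section Channel

variable {d e : ℕ} (V : EmbIsometry d e)

theorem isometryChannel_apply (X : Matrix (Fin d) (Fin d) ℂ) (i j : Fin e) :
    isometryChannel V X i j = ∑ k, (V.1 * X * V.1ᴴ) (i, k) (j, k) := rfl

theorem trace_isometryChannel (X : Matrix (Fin d) (Fin d) ℂ) :
    (isometryChannel V X).trace = X.trace := by
  have h : (isometryChannel V X).trace = (V.1 * X * V.1ᴴ).trace := by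
    simp only [Matrix.trace, diag_apply, isometryChannel_apply, Fintype.sum_prod_type]
  rw [h, Matrix.mul_assoc, trace_mul_comm, Matrix.mul_assoc, V.2, Matrix.mul_one]

theorem isHermitian_isometryChannel {X : Matrix (Fin d) (Fin d) ℂ} (hX : X.IsHermitian) :
    (isometryChannel V X).IsHermitian := by
  have h : (V.1 * X * V.1ᴴ).IsHermitian := isHermitian_mul_mul_conjTranspose _ hX
  ext i j
  simp only [conjTranspose_apply, isometryChannel_apply, star_sum]
  exact Finset.sum_congr rfl fun k _ => h.apply _ _

theorem isometryChannel_vecMulVec (v : Fin d → ℂ) :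
    isometryChannel V (vecMulVec v (star v)) =
      of (Function.curry (V.1 *ᵥ v)) * (of (Function.curry (V.1 *ᵥ v)))ᴴ := by
  have h : V.1 * vecMulVec v (star v) * V.1ᴴ = vecMulVec (V.1 *ᵥ v) (star (V.1 *ᵥ v)) := by
    rw [mul_vecMulVec, vecMulVec_mul, star_mulVec]
  ext i j
  rw [isometryChannel_apply, h, Matrix.mul_apply]
  rfl

theorem isState_isometryChannel_vecMulVec {v : Fin d → ℂ} (hv : star v ⬝ᵥ v = 1) :
    IsState (isometryChannel V (vecMulVec v (star v))) := by
  refine ⟨?_, ?_⟩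
  · rw [isometryChannel_vecMulVec]
    exact posSemidef_self_mul_conjTranspose _
  · rw [trace_isometryChannel, trace_vecMulVec, dotProduct_comm, hv]

/-- `𝓔_V` is a sum of Kraus maps, one for each basis vector of the discarded system. -/
theorem isChannel_isometryChannel : IsChannel (isometryChannel V) := by
  refine ⟨trace_isometryChannel V, fun k X hX => ?_⟩
  let M : Fin (anc d e) → Matrix (Fin e × Fin k) (Fin d × Fin k) ℂ := fun c =>
    of fun p q => if p.2 = q.2 then V.1 (p.1, c) q.1 else 0
  have h : (of fun (p q : Fin e × Fin k) =>
      isometryChannel V (of fun i j => X (i, p.2) (j, q.2)) p.1 q.1) =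
      ∑ c, M c * X * (M c)ᴴ := by
    ext p q
    rw [Matrix.sum_apply, of_apply, isometryChannel_apply]
    refine Finset.sum_congr rfl fun c _ => ?_
    simp [M, Matrix.mul_apply, Fintype.sum_prod_type, apply_ite]
  rw [h]
  exact posSemidef_sum _ fun c _ => hX.mul_mul_conjTranspose_same (M c)

theorem measurable_isometryChannel_apply (X : Matrix (Fin d) (Fin d) ℂ) (i j : Fin e) :
    Measurable fun V : EmbIsometry d e => isometryChannel V X i j := by
  refine Continuous.measurable ?_
  simp only [isometryChannel_apply]
  refine continuous_finsetSum _ fun k _ => Continuous.matrix_elem ?_ _ _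
  fun_prop

theorem star_eigenvector_dotProduct_self {n : Type*} [Fintype n] [DecidableEq n]
    {X : Matrix n n ℂ} (hX : X.IsHermitian) (i : n) :
    star ((hX.eigenvectorUnitary : Matrix n n ℂ).col i) ⬝ᵥ
      (hX.eigenvectorUnitary : Matrix n n ℂ).col i = 1 := by
  have h : ((hX.eigenvectorUnitary : Matrix n n ℂ)ᴴ * (hX.eigenvectorUnitary : Matrix n n ℂ)) i i
      = 1 := by
    have := Unitary.coe_star_mul_self hX.eigenvectorUnitary
    rw [star_eq_conjTranspose] at this
    rw [this, one_apply_eq]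
  exact h

theorem isometryChannel_eq_sum {X : Matrix (Fin d) (Fin d) ℂ} (hX : X.IsHermitian) :
    isometryChannel V X = ∑ i, (hX.eigenvalues i : ℂ) • isometryChannel V
      (vecMulVec ((hX.eigenvectorUnitary : Matrix (Fin d) (Fin d) ℂ).col i)
        (star ((hX.eigenvectorUnitary : Matrix (Fin d) (Fin d) ℂ).col i))) := by
  conv_lhs => rw [eq_sum_eigenvalues_smul hX]
  rw [map_sum]
  simp only [map_smul]

theorem traceNorm_isometryChannel_le {X : Matrix (Fin d) (Fin d) ℂ} (hX : X.IsHermitian) :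
    traceNorm (isometryChannel V X) ≤ traceNorm X := by
  rw [traceNorm_eq_sum_abs_eigenvalues hX]
  exact traceNorm_le_sum_abs (isHermitian_isometryChannel V hX) _ _
    (fun i => isState_isometryChannel_vecMulVec V (star_eigenvector_dotProduct_self hX i))
    (isometryChannel_eq_sum V hX)

/-- With output dimension `d` the discarded system is trivial and the channel is unitary. -/
theorem traceNorm_isometryChannel_of_dim_eq (hd : 0 < d) (V : EmbIsometry d d)
    (X : Matrix (Fin d) (Fin d) ℂ) : traceNorm (isometryChannel V X) = traceNorm X := by
  have hanc : anc d d = 1 := by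
    exact le_antisymm ((ceilDiv_le_iff_le_smul hd).2 (by simp))
      (Nat.one_le_iff_ne_zero.2 fun h => by
        have := le_smul_ceilDiv (α := ℕ) (β := ℕ) (a := d) (b := d) hd
        rw [smul_eq_mul, show d ⌈/⌉ d = 0 from h] at this
        omega)
  have hcard : Unique (Fin (anc d d)) := by rw [hanc]; infer_instance
  let W : Matrix (Fin d) (Fin d) ℂ := V.1.submatrix (fun i => (i, default)) id
  have hW : Wᴴ * W = 1 := by
    rw [← V.2]
    ext i j
    simp [W, Matrix.mul_apply, Fintype.sum_prod_type]
  have h : isometryChannel V X = W * X * Wᴴ := by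
    ext i j
    rw [isometryChannel_apply]
    simp [W, Matrix.mul_apply]
  rw [h, traceNorm_mul_mul_conjTranspose hW]

end Channel

/-! ### Lower bound for the trace norm of the output -/

/-- The operator `A : ℂ^I → ℂ^a ⊗ ℂ^b` with the second tensor factor moved to the source: its
columns are the components in `ℂ^a` of the columns of `A`. -/
def unfoldLeft {a b I : Type*} (A : Matrix (a × b) I ℂ) : Matrix a (I × b) ℂ :=
  of fun x p => A (x, p.2) p.1

/-- A matrix regarded as a vector in the tensor product. -/
def flatten (a b : Type*) : Matrix a b ℂ →ₗ[ℂ] (a × b → ℂ) where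
  toFun B := fun q => B q.1 q.2
  map_add' _ _ := rfl
  map_smul' _ _ := rfl

theorem norm_sq_toLp_flatten {a b : Type*} [Fintype a] [Fintype b] (B : Matrix a b ℂ) :
    ‖(WithLp.toLp 2 (flatten a b B) : EuclideanSpace ℂ (a × b))‖ ^ 2 = (B * Bᴴ).trace.re := by
  rw [EuclideanSpace.norm_sq_eq]
  simp only [Matrix.trace, diag_apply, Matrix.mul_apply, Fintype.sum_prod_type, Complex.re_sum,
    conjTranspose_apply]
  refine Finset.sum_congr rfl fun i _ => Finset.sum_congr rfl fun j _ => ?_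
  rw [Complex.star_def, Complex.mul_conj, Complex.normSq_eq_norm_sq, Complex.ofReal_re]
  rfl

/-- A linear map whose range is `T ⊗ ℂ^b`, where `T ⊆ ℂ^a` is the joint support of the reductions
to `ℂ^a` of the columns of `A`. -/
def supportMap {a b I : Type*} [Fintype b] [Fintype I] (A : Matrix (a × b) I ℂ) :
    Matrix (I × b) b ℂ →ₗ[ℂ] (a × b → ℂ) :=
  flatten a b ∘ₗ mulLeftLinearMap b ℂ (unfoldLeft A)

theorem supportMap_apply {a b I : Type*} [Fintype b] [Fintype I] (A : Matrix (a × b) I ℂ)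
    (Z : Matrix (I × b) b ℂ) (q : a × b) :
    supportMap A Z q = ∑ p : I × b, A (q.1, p.2) p.1 * Z p q.2 := rfl

/-- Suppose that the images of all the non-positive eigenvectors of a traceless Hermitian `X` stay
at squared distance at least `1 - ε` from `T ⊗ ℂ^k`, where `T` is the joint support of the reduced
images of the positive eigenvectors. Then measuring the projection onto `T` shows that the channel
shrinks the trace norm of `X` by a factor of at most `1 - ε`. -/
theorem le_traceNorm_isometryChannel {d e : ℕ} (V : EmbIsometry d e) {ε : ℝ}
    {X : Matrix (Fin d) (Fin d) ℂ} (hX : X.IsHermitian) (htr : X.trace = 0)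
    (hfar : ∀ j, ¬ 0 < hX.eigenvalues j →
      ∀ Z : Matrix ({i // 0 < hX.eigenvalues i} × Fin (anc d e)) (Fin (anc d e)) ℂ,
        1 - ε ≤ ‖(WithLp.toLp 2
          (V.1 *ᵥ (hX.eigenvectorUnitary : Matrix (Fin d) (Fin d) ℂ).col j -
            supportMap (V.1 * (hX.eigenvectorUnitary : Matrix (Fin d) (Fin d) ℂ).submatrix id
              Subtype.val) Z) : EuclideanSpace ℂ _)‖ ^ 2) :
    (1 - ε) * traceNorm X ≤ traceNorm (isometryChannel V X) := by
  set W := (hX.eigenvectorUnitary : Matrix (Fin d) (Fin d) ℂ)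
  set M := unfoldLeft (V.1 * W.submatrix id
    (Subtype.val : {i // 0 < hX.eigenvalues i} → Fin d)) with hM
  obtain ⟨P, N, hPh, hPP, hPM, hPN⟩ := exists_rangeProjection M
  let Y : Fin d → Matrix (Fin e) (Fin (anc d e)) ℂ := fun i =>
    of (Function.curry (V.1 *ᵥ W.col i))
  have hP : P.PosSemidef := by
    have := posSemidef_conjTranspose_mul_self P
    rwa [hPh, hPP] at this
  have hPh' : (1 - P)ᴴ = 1 - P := by rw [conjTranspose_sub, conjTranspose_one, hPh]
  have hPP' : (1 - P) * (1 - P) = 1 - P := by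
    rw [Matrix.sub_mul, Matrix.one_mul, Matrix.mul_sub, Matrix.mul_one, hPP, sub_self, sub_zero]
  have hP' : (1 - P).PosSemidef := by
    have := posSemidef_conjTranspose_mul_self (1 - P)
    rwa [hPh', hPP'] at this
  have hYtr : ∀ i, (Y i * (Y i)ᴴ).trace = 1 := by
    intro i
    rw [← isometryChannel_vecMulVec]
    exact (isState_isometryChannel_vecMulVec V (star_eigenvector_dotProduct_self hX i)).2
  have hE : isometryChannel V X = ∑ i, (hX.eigenvalues i : ℂ) • (Y i * (Y i)ᴴ) := by
    rw [isometryChannel_eq_sum V hX]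
    exact Finset.sum_congr rfl fun i _ => by rw [isometryChannel_vecMulVec]
  have hpos : ∀ i, 0 < hX.eigenvalues i → (P * (Y i * (Y i)ᴴ)).trace.re = 1 := by
    intro i hi
    have hPY : P * Y i = Y i := by
      have hcol : Y i = M.submatrix id fun k => (⟨i, hi⟩, k) := by
        ext x k
        simp [Y, hM, unfoldLeft, Matrix.mul_apply, mulVec, dotProduct, Function.curry]
      have h1 : P * M.submatrix id (fun k => ((⟨i, hi⟩ : {i // 0 < hX.eigenvalues i}), k)) =
          (P * M).submatrix id (fun k => (⟨i, hi⟩, k)) := by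
        ext x k; simp [Matrix.mul_apply]
      rw [hcol, h1, hPM]
    rw [← Matrix.mul_assoc, hPY, hYtr, Complex.one_re]
  have hneg : ∀ i, ¬ 0 < hX.eigenvalues i → (P * (Y i * (Y i)ᴴ)).trace.re ≤ ε := by
    intro i hi
    have h1 := hfar i hi (N * Y i)
    have h2 : V.1 *ᵥ W.col i - supportMap (V.1 * W.submatrix id
        (Subtype.val : {i // 0 < hX.eigenvalues i} → Fin d)) (N * Y i) =
        flatten (Fin e) (Fin (anc d e)) ((1 - P) * Y i) := by
      change V.1 *ᵥ W.col i - flatten (Fin e) (Fin (anc d e)) (M * (N * Y i)) = _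
      rw [← Matrix.mul_assoc, ← hPN, Matrix.sub_mul, Matrix.one_mul, map_sub]
      rfl
    rw [h2, norm_sq_toLp_flatten] at h1
    have h3 : ((1 - P) * Y i * ((1 - P) * Y i)ᴴ).trace =
        1 - (P * (Y i * (Y i)ᴴ)).trace := by
      rw [conjTranspose_mul, hPh', ← Matrix.mul_assoc, trace_mul_comm, ← Matrix.mul_assoc,
        ← Matrix.mul_assoc, hPP', Matrix.mul_assoc, Matrix.sub_mul, Matrix.one_mul, trace_sub,
        hYtr]
    rw [h3, Complex.sub_re, Complex.one_re] at h1
    linarith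
  have hsum0 : ∑ i, hX.eigenvalues i = 0 := by
    have := congrArg Complex.re hX.trace_eq_sum_eigenvalues
    rw [htr, Complex.re_sum] at this
    exact this.symm
  have hpair := two_mul_trace_sub_trace_le_traceNorm (isHermitian_isometryChannel V hX) hP hP'
  rw [trace_isometryChannel, htr, Complex.zero_re, sub_zero] at hpair
  refine le_trans ?_ hpair
  have hPE : (P * isometryChannel V X).trace.re =
      ∑ i, hX.eigenvalues i * (P * (Y i * (Y i)ᴴ)).trace.re := by
    rw [hE, Matrix.mul_sum, trace_sum, Complex.re_sum]
    refine Finset.sum_congr rfl fun i _ => ?_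
    rw [Matrix.mul_smul, trace_smul, smul_eq_mul, Complex.re_ofReal_mul]
  rw [hPE, traceNorm_eq_sum_abs_eigenvalues hX, Finset.mul_sum, Finset.mul_sum]
  -- The eigenvalues sum to zero, so a multiple of their sum may be added to either side.
  have h5 : ∑ i, (1 - ε) * |hX.eigenvalues i| =
      ∑ i, ((1 - ε) * |hX.eigenvalues i| + (1 + ε) * hX.eigenvalues i) := by
    rw [Finset.sum_add_distrib, ← Finset.mul_sum, ← Finset.mul_sum, hsum0, mul_zero, add_zero]
  rw [h5]
  refine Finset.sum_le_sum fun i _ => ?_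
  by_cases hi : 0 < hX.eigenvalues i
  · rw [hpos i hi, abs_of_pos hi]
    linarith
  · have := hneg i hi
    rw [abs_of_nonpos (not_lt.1 hi)]
    nlinarith [not_lt.1 hi]

/-! ### The probability of failure -/

section Failure

variable {a b I : Type*} [Fintype a] [Fintype b] [DecidableEq a] [DecidableEq b]
  [Fintype I]

/-- The pairs `(U, x)` such that `U x`, regarded as an `a × b` matrix, is closer than
`√(1 - ε) ‖x‖` to a matrix whose columns lie in the joint support of the reductions to `ℂ^a` of the
columns of `U A`. -/
def nearSupport (ε : ℝ) (A : Matrix (a × b) I ℂ) :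
    Set (unitaryGroup (a × b) ℂ × EuclideanSpace ℂ (a × b)) :=
  {p | ∃ Z : Matrix (I × b) b ℂ,
    ‖(WithLp.toLp 2 ((p.1 : Matrix (a × b) (a × b) ℂ) *ᵥ p.2.ofLp -
      supportMap ((p.1 : Matrix (a × b) (a × b) ℂ) * A) Z) :
        EuclideanSpace ℂ (a × b))‖ ^ 2 < (1 - ε) * ‖p.2‖ ^ 2}

theorem isOpen_nearSupport (ε : ℝ) (A : Matrix (a × b) I ℂ) : IsOpen (nearSupport ε A) := by
  unfold nearSupport
  rw [Set.ofPred_exists]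
  refine isOpen_iUnion fun Z => isOpen_lt ?_ (by fun_prop)
  have h : Continuous fun p : unitaryGroup (a × b) ℂ × EuclideanSpace ℂ (a × b) =>
      supportMap ((p.1 : Matrix (a × b) (a × b) ℂ) * A) Z := by
    refine continuous_pi fun q => ?_
    have hU : ∀ i j, Continuous fun p : unitaryGroup (a × b) ℂ × EuclideanSpace ℂ (a × b) =>
        (p.1 : Matrix (a × b) (a × b) ℂ) i j := fun i j =>
      (continuous_subtype_val.comp continuous_fst).matrix_elem i j
    simp only [supportMap_apply, Matrix.mul_apply]
    exact continuous_finsetSum _ fun p _ => (continuous_finsetSum _ fun j _ =>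
      (hU _ _).mul continuous_const).mul continuous_const
  fun_prop

theorem norm_toLp_unitary_mulVec {m : Type*} [Fintype m] [DecidableEq m] (U : unitaryGroup m ℂ)
    (v : m → ℂ) :
    ‖(WithLp.toLp 2 ((U : Matrix m m ℂ) *ᵥ v) : EuclideanSpace ℂ m)‖ = ‖WithLp.toLp 2 v‖ := by
  have h1 := star_dotProduct_self_eq_norm_sq
    (WithLp.toLp 2 ((U : Matrix m m ℂ) *ᵥ v) : EuclideanSpace ℂ m)
  have hU : (U : Matrix m m ℂ)ᴴ * (U : Matrix m m ℂ) = 1 := Unitary.coe_star_mul_self U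
  rw [star_mulVec, ← dotProduct_mulVec, mulVec_mulVec, hU, one_mulVec,
    star_dotProduct_self_eq_norm_sq (WithLp.toLp 2 v)] at h1
  have h2 : ‖WithLp.toLp 2 v‖ ^ 2 =
      ‖(WithLp.toLp 2 ((U : Matrix m m ℂ) *ᵥ v) : EuclideanSpace ℂ m)‖ ^ 2 := by
    exact_mod_cast h1
  exact ((sq_eq_sq₀ (norm_nonneg _) (norm_nonneg _)).1 h2).symm

theorem norm_sub_mulVec_conjTranspose_mulVec_le {m : Type*} [Fintype m] [DecidableEq I]
    (A : Matrix m I ℂ) (hA : Aᴴ * A = 1) (g : EuclideanSpace ℂ m) :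
    ‖g - WithLp.toLp 2 (A *ᵥ (Aᴴ *ᵥ g.ofLp))‖ ^ 2 ≤ ‖g‖ ^ 2 := by
  set c := Aᴴ *ᵥ g.ofLp with hc
  have h1 := star_dotProduct_self_eq_norm_sq (g - WithLp.toLp 2 (A *ᵥ c))
  have h2 := star_dotProduct_self_eq_norm_sq g
  have h3 := star_dotProduct_self_eq_norm_sq (WithLp.toLp 2 c : EuclideanSpace ℂ I)
  have e1 : star (A *ᵥ c) ⬝ᵥ g.ofLp = star c ⬝ᵥ c := by
    rw [star_mulVec, ← dotProduct_mulVec, ← hc]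
  have e2 : star g.ofLp ⬝ᵥ (A *ᵥ c) = star c ⬝ᵥ c := by
    have := congrArg star e1
    rwa [← star_dotProduct, ← star_dotProduct] at this
  have e3 : star (A *ᵥ c) ⬝ᵥ (A *ᵥ c) = star c ⬝ᵥ c := by
    rw [star_mulVec, ← dotProduct_mulVec, mulVec_mulVec, hA, one_mulVec]
  simp only [WithLp.ofLp_sub, star_sub, sub_dotProduct, dotProduct_sub, e1, e2, e3, h2] at h1 h3
  rw [h3] at h1
  have h4 : ‖g‖ ^ 2 - ‖(WithLp.toLp 2 c : EuclideanSpace ℂ I)‖ ^ 2 =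
      ‖g - WithLp.toLp 2 (A *ᵥ c)‖ ^ 2 := by
    have : ((‖g‖ ^ 2 - ‖(WithLp.toLp 2 c : EuclideanSpace ℂ I)‖ ^ 2 : ℝ) : ℂ) =
      ((‖g - WithLp.toLp 2 (A *ᵥ c)‖ ^ 2 : ℝ) : ℂ) := by
      rw [← h1]; push_cast; ring
    exact_mod_cast this
  rw [← h4]
  linarith [sq_nonneg ‖(WithLp.toLp 2 c : EuclideanSpace ℂ I)‖]

/-- For fixed `U`, the vectors close to the support form a Gaussian-rare event: they are close to
a subspace of dimension at most `|I| |b|²`, which contains the columns of `A`. -/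
theorem stdGaussian_real_nearSupport_le [DecidableEq I] {ε : ℝ} (hε₀ : 0 < ε) (hε₁ : ε < 1)
    (A : Matrix (a × b) I ℂ) (hA : Aᴴ * A = 1)
    (hdim : ((Fintype.card I * Fintype.card b * Fintype.card b : ℕ) : ℝ) ≤
      ε / 2 * Fintype.card (a × b)) (U : unitaryGroup (a × b) ℂ) :
    (ProbabilityTheory.stdGaussian (EuclideanSpace ℂ (a × b))).real
      {g | (U, g - WithLp.toLp 2 (A *ᵥ (Aᴴ *ᵥ g.ofLp))) ∈ nearSupport ε A} ≤
      Real.exp ((Fintype.card I * Fintype.card b * Fintype.card b : ℕ) * Real.log 2 -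
        ε / 2 * Fintype.card (a × b)) := by
  have hU : (U : Matrix (a × b) (a × b) ℂ)ᴴ * (U : Matrix (a × b) (a × b) ℂ) = 1 :=
    Unitary.coe_star_mul_self U
  have hU' : (U : Matrix (a × b) (a × b) ℂ) * (U : Matrix (a × b) (a × b) ℂ)ᴴ = 1 :=
    Unitary.coe_mul_star_self U
  set S := supportMap ((U : Matrix (a × b) (a × b) ℂ) * A) with hS
  let L : Matrix (I × b) b ℂ →ₗ[ℂ] EuclideanSpace ℂ (a × b) :=
    (WithLp.linearEquiv 2 ℂ (a × b → ℂ)).symm.toLinearMap ∘ₗ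
      (U : Matrix (a × b) (a × b) ℂ)ᴴ.mulVecLin ∘ₗ S
  have hL : ∀ Z, L Z =
      WithLp.toLp 2 ((U : Matrix (a × b) (a × b) ℂ)ᴴ *ᵥ S Z) := fun Z => rfl
  have hR : Module.finrank ℂ (LinearMap.range L) ≤
      Fintype.card I * Fintype.card b * Fintype.card b := by
    refine (LinearMap.finrank_range_le L).trans ?_
    simp [Module.finrank_matrix]
  refine (measureReal_mono ?_).trans
    (stdGaussian_real_near_complex_submodule_le (LinearMap.range L) hε₀ hε₁ hR hdim)
  rintro g ⟨Z, hZ⟩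
  -- The vector `Z₀` shows that the range of `L` contains the range of `A`.
  let Z₀ : Matrix (I × b) b ℂ := of fun p j => if p.2 = j then (Aᴴ *ᵥ g.ofLp) p.1 else 0
  have hZ₀ : L Z₀ = WithLp.toLp 2 (A *ᵥ (Aᴴ *ᵥ g.ofLp)) := by
    have : S Z₀ =
        (U : Matrix (a × b) (a × b) ℂ) *ᵥ (A *ᵥ (Aᴴ *ᵥ g.ofLp)) := by
      rw [mulVec_mulVec]
      ext q
      rw [hS, supportMap_apply, Fintype.sum_prod_type]
      simp [Z₀, mulVec, dotProduct]
    rw [hL, this, mulVec_mulVec, hU, one_mulVec]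
  refine ⟨L Z₀ + L Z, Submodule.add_mem _ ⟨Z₀, rfl⟩ ⟨Z, rfl⟩, ?_⟩
  set g' := g - WithLp.toLp 2 (A *ᵥ (Aᴴ *ᵥ g.ofLp)) with hg'
  have h1 : g - (L Z₀ + L Z) = WithLp.toLp 2 (g'.ofLp - (L Z).ofLp) := by
    rw [hZ₀, ← sub_sub, ← hg']; rfl
  have h2 : (U : Matrix (a × b) (a × b) ℂ) *ᵥ (L Z).ofLp = S Z := by
    rw [hL, mulVec_mulVec, hU', one_mulVec]
  rw [h1, ← norm_toLp_unitary_mulVec U, mulVec_sub, h2]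
  refine hZ.trans_le ?_
  exact mul_le_mul_of_nonneg_left (norm_sub_mulVec_conjTranspose_mulVec_le A hA g) (by linarith)

/-- A fixed non-zero vector orthogonal to the columns of `A` is unlikely to be moved close to the
support of the image of `A`. -/
theorem haarUnitary_real_nearSupport_le [DecidableEq I] {ε : ℝ} (hε₀ : 0 < ε) (hε₁ : ε < 1)
    (A : Matrix (a × b) I ℂ) (hA : Aᴴ * A = 1)
    (hdim : ((Fintype.card I * Fintype.card b * Fintype.card b : ℕ) : ℝ) ≤
      ε / 2 * Fintype.card (a × b)) {x : EuclideanSpace ℂ (a × b)} (hx : x ≠ 0)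
    (hAx : Aᴴ *ᵥ x.ofLp = 0) :
    (haarUnitary (a × b)).real {U | (U, x) ∈ nearSupport ε A} ≤
      Real.exp ((Fintype.card I * Fintype.card b * Fintype.card b : ℕ) * Real.log 2 -
        ε / 2 * Fintype.card (a × b)) := by
  refine haarUnitary_real_le_of_forall_stdGaussian_real_le A hA (isOpen_nearSupport ε A) ?_ ?_
    (stdGaussian_real_nearSupport_le hε₀ hε₁ A hA hdim) hx hAx
  · rintro U x c hc ⟨Z, hZ⟩
    refine ⟨c • Z, ?_⟩
    have hc2 : 0 < ‖c‖ ^ 2 := by positivity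
    have h1 : (WithLp.toLp 2 ((U : Matrix (a × b) (a × b) ℂ) *ᵥ (c • x).ofLp -
        supportMap ((U : Matrix (a × b) (a × b) ℂ) * A) (c • Z)) :
          EuclideanSpace ℂ (a × b)) =
        c • WithLp.toLp 2 ((U : Matrix (a × b) (a × b) ℂ) *ᵥ x.ofLp -
          supportMap ((U : Matrix (a × b) (a × b) ℂ) * A) Z) := by
      rw [WithLp.ofLp_smul, mulVec_smul, map_smul, ← smul_sub, WithLp.toLp_smul]
    dsimp only at hZ ⊢
    rw [h1, norm_smul, norm_smul, mul_pow, mul_pow, mul_left_comm]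
    exact mul_lt_mul_of_pos_left hZ hc2
  · rintro U W x hWA ⟨Z, hZ⟩
    refine ⟨Z, ?_⟩
    have hUA : ((U * W : unitaryGroup (a × b) ℂ) : Matrix (a × b) (a × b) ℂ) * A =
        (U : Matrix (a × b) (a × b) ℂ) * A := by
      rw [Submonoid.coe_mul, Matrix.mul_assoc, hWA]
    dsimp only at hZ ⊢
    rw [hUA, Submonoid.coe_mul, ← mulVec_mulVec] at hZ
    rwa [norm_toLp_unitary_mulVec]

end Failure

/-- The exponent of the Gaussian bound, for total dimension `D = e k ∈ [d, 2d]`. -/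
theorem exponent_bound {ε d e k s : ℝ} (hε₀ : 0 < ε) (hd : 0 < d) (he : 0 < e) (hk : 0 < k)
    (h1 : 4 * s * d ≤ ε * e ^ 2) (hD : d ≤ e * k) (hD' : e * k ≤ 2 * d) :
    s * k * k ≤ ε / 2 * (e * k) ∧ s * k * k * Real.log 2 - ε / 2 * (e * k) ≤ -K * ε * d := by
  have hL := Real.log_two_gt_d9
  have hL' := Real.log_two_lt_d9
  set D := e * k with hDdef
  set L := Real.log 2
  have h2 : 4 * d * (s * k * k) ≤ ε * D ^ 2 := by
    have := mul_le_mul_of_nonneg_right h1 (sq_nonneg k)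
    rw [hDdef]; nlinarith
  have hDpos : 0 < D := by positivity
  have hDD : D ^ 2 ≤ 3 * d * D - 2 * d ^ 2 := by nlinarith
  -- `s k² ≤ ε D² / (4 d)`, and the chord bounds the convex function `D²` on `[d, 2d]`.
  have h3 : s * k * k ≤ ε * (3 * D - 2 * d) / 4 := by
    have : 4 * d * (s * k * k) ≤ 4 * d * (ε * (3 * D - 2 * d) / 4) := by
      have := mul_le_mul_of_nonneg_left hDD hε₀.le
      nlinarith
    exact le_of_mul_le_mul_left this (by positivity)
  refine ⟨?_, ?_⟩
  · nlinarith
  · have hK : K ≤ 1 - L := by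
      unfold K
      rw [div_le_iff₀ (by positivity)]
      nlinarith
    have h4 : s * k * k * L ≤ ε * (3 * D - 2 * d) / 4 * L :=
      mul_le_mul_of_nonneg_right h3 (by linarith)
    have h5 : (3 * D - 2 * d) / 4 * L - D / 2 ≤ -(1 - L) * d := by nlinarith
    have h6 : K * d ≤ (1 - L) * d := mul_le_mul_of_nonneg_right hK hd.le
    nlinarith

theorem le_mul_anc (d : ℕ) {e : ℕ} (he : 0 < e) : d ≤ e * anc d e := by
  simpa using le_smul_ceilDiv (α := ℕ) (β := ℕ) (a := e) (b := d) he

theorem mul_anc_lt_add (d : ℕ) {e : ℕ} (he : 0 < e) : e * anc d e < d + e := by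
  by_contra h
  push Not at h
  have h1 : anc d e ≠ 0 := fun h0 => by rw [h0] at h; omega
  obtain ⟨c, hc⟩ := Nat.exists_eq_succ_of_ne_zero h1
  have h2 : d ≤ e • c := by
    rw [hc, Nat.mul_succ] at h; rw [smul_eq_mul]; omega
  have := (ceilDiv_le_iff_le_smul (α := ℕ) he).2 h2
  change anc d e ≤ c at this
  omega

/-- The distance between two states, one of which has low rank, is approximately preserved with
high probability. -/
theorem one_sub_le_uniformIsometry_real {ε : ℝ} (hε₀ : 0 < ε) (hε₁ : ε < 1) {d e : ℕ}
    {ρ σ : Matrix (Fin d) (Fin d) ℂ} (hρ : IsState ρ) (hσ : IsState σ)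
    (he : 2 * √((ρ.rank : ℝ) * d / ε) ≤ e) (hed : e ≤ d) (V₀ : EmbIsometry d e) :
    1 - (d : ℝ) * Real.exp (-K * ε * d) ≤ (uniformIsometry V₀).real
      {V | (1 - ε) * traceNorm (ρ - σ) ≤
        traceNorm (isometryChannel V ρ - isometryChannel V σ)} := by
  have hX : (ρ - σ).IsHermitian := hρ.1.1.sub hσ.1.1
  have htr : (ρ - σ).trace = 0 := by rw [trace_sub, hρ.2, hσ.2, sub_self]
  have hρ0 : ρ ≠ 0 := by
    rintro rfl
    simpa using hρ.2
  have hd : 0 < d := by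
    rcases Nat.eq_zero_or_pos d with rfl | h
    · exact (hρ0 (Subsingleton.elim _ _)).elim
    · exact h
  have hr : 0 < ρ.rank := Nat.pos_of_ne_zero fun h => hρ0 (toLin'.injective <| by
    rw [map_zero]
    exact LinearMap.range_eq_bot.1 (Submodule.finrank_eq_zero.1 h))
  have hd' : (0 : ℝ) < d := by exact_mod_cast hd
  have hr' : (0 : ℝ) < ρ.rank := by exact_mod_cast hr
  have he' : (0 : ℝ) < e := lt_of_lt_of_le (by positivity) he
  have he0 : 0 < e := by exact_mod_cast he'
  have hDle := le_mul_anc d he0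
  have hDlt := mul_anc_lt_add d he0
  have hk0 : 0 < anc d e := Nat.pos_of_ne_zero fun h => by rw [h] at hDle; omega
  set W := (hX.eigenvectorUnitary : Matrix (Fin d) (Fin d) ℂ)
  have hW : Wᴴ * W = 1 := Unitary.coe_star_mul_self hX.eigenvectorUnitary
  set s := Fintype.card {i // 0 < hX.eigenvalues i}
  have hs : s ≤ ρ.rank := card_pos_eigenvalues_sub_le_rank hσ.1 hX
  have h4 : 4 * (s : ℝ) * d ≤ ε * (e : ℝ) ^ 2 := by
    have h5 : 4 * ((ρ.rank : ℝ) * d / ε) ≤ (e : ℝ) ^ 2 := by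
      have := pow_le_pow_left₀ (by positivity) he 2
      rwa [mul_pow, Real.sq_sqrt (by positivity), show (2 : ℝ) ^ 2 = 4 by norm_num] at this
    have h6 : 4 * (ρ.rank : ℝ) * d ≤ ε * (e : ℝ) ^ 2 := by
      have := mul_le_mul_of_nonneg_left h5 hε₀.le
      field_simp at this
      linarith
    have h7 : (s : ℝ) ≤ ρ.rank := by exact_mod_cast hs
    nlinarith
  obtain ⟨hdim, hexp⟩ := exponent_bound (k := anc d e) hε₀ hd' he' (by exact_mod_cast hk0) h4
    (by exact_mod_cast hDle) (by
      have : e * anc d e ≤ 2 * d := by omega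
      exact_mod_cast this)
  let B : Matrix (Fin d) {i // 0 < hX.eigenvalues i} ℂ := W.submatrix id Subtype.val
  let A := V₀.1 * B
  have hVV : ∀ {J : Type} (C : Matrix (Fin d) J ℂ), V₀.1ᴴ * (V₀.1 * C) = C := fun C => by
    rw [← Matrix.mul_assoc, V₀.2, Matrix.one_mul]
  have hA : Aᴴ * A = 1 := by
    rw [conjTranspose_mul, Matrix.mul_assoc, hVV]
    ext i j
    have := congrFun (congrFun hW i.1) j.1
    rw [one_apply] at this ⊢
    simpa [B, Matrix.mul_apply, Subtype.ext_iff] using this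
  let x : Fin d → EuclideanSpace ℂ (Fin e × Fin (anc d e)) := fun j =>
    WithLp.toLp 2 (V₀.1 *ᵥ W.col j)
  have hxnorm : ∀ j, ‖x j‖ ^ 2 = 1 := by
    intro j
    have h1 := star_dotProduct_self_eq_norm_sq (x j)
    change star (V₀.1 *ᵥ W.col j) ⬝ᵥ (V₀.1 *ᵥ W.col j) = _ at h1
    rw [star_mulVec, ← dotProduct_mulVec, mulVec_mulVec, V₀.2, one_mulVec,
      star_eigenvector_dotProduct_self hX j] at h1
    exact_mod_cast h1.symm
  have hx0 : ∀ j, x j ≠ 0 := fun j h => by simpa [h] using hxnorm j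
  have hAx : ∀ j, ¬ 0 < hX.eigenvalues j → Aᴴ *ᵥ (x j).ofLp = 0 := by
    intro j hj
    change Aᴴ *ᵥ (V₀.1 *ᵥ W.col j) = 0
    rw [conjTranspose_mul, ← mulVec_mulVec, mulVec_mulVec _ V₀.1ᴴ, V₀.2, one_mulVec]
    ext i
    have hij : i.1 ≠ j := fun h => hj (h ▸ i.2)
    have := congrFun (congrFun hW i.1) j
    rw [one_apply_ne hij] at this
    exact this
  let bad : Fin d → Set (unitaryGroup (Fin e × Fin (anc d e)) ℂ) := fun j =>
    {U | ¬ 0 < hX.eigenvalues j ∧ (U, x j) ∈ nearSupport ε A}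
  have hbadMeas : ∀ j, MeasurableSet (bad j) := fun j =>
    (MeasurableSet.const _).inter
      ((isOpen_nearSupport ε A).preimage (Continuous.prodMk_left (x j))).measurableSet
  have hbad : ∀ j, (haarUnitary (Fin e × Fin (anc d e))).real (bad j) ≤
      Real.exp (-K * ε * d) := by
    intro j
    by_cases hj : 0 < hX.eigenvalues j
    · have : bad j = ∅ := by ext U; simp [bad, hj]
      rw [this, measureReal_empty]
      positivity
    · refine (measureReal_mono fun U hU => hU.2).trans
        ((haarUnitary_real_nearSupport_le hε₀ hε₁ A hA ?_ (hx0 j) (hAx j hj)).trans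
          (Real.exp_le_exp.2 ?_))
      · simpa using hdim
      · simpa using hexp
  have hgood : (⋃ j, bad j)ᶜ ⊆ (fun U => rotate U V₀) ⁻¹' {V | (1 - ε) * traceNorm (ρ - σ) ≤
        traceNorm (isometryChannel V ρ - isometryChannel V σ)} := by
    intro U hU
    change (1 - ε) * traceNorm (ρ - σ) ≤
        traceNorm (isometryChannel (rotate U V₀) ρ - isometryChannel (rotate U V₀) σ)
    rw [← map_sub]
    refine le_traceNorm_isometryChannel _ hX htr fun j hj Z => ?_
    by_contra hlt
    refine hU (Set.mem_iUnion.2 ⟨j, hj, Z, ?_⟩)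
    have h1 : (rotate U V₀).1 *ᵥ W.col j =
        (U : Matrix _ _ ℂ) *ᵥ (x j).ofLp := (mulVec_mulVec _ _ _).symm
    have h2 : supportMap ((rotate U V₀).1 * B) =
        supportMap ((U : Matrix (Fin e × Fin (anc d e)) (Fin e × Fin (anc d e)) ℂ) * A) :=
      congrArg supportMap (Matrix.mul_assoc _ _ _)
    dsimp only
    rw [hxnorm, mul_one, ← h1, ← h2]
    exact not_le.1 hlt
  have hunion : (haarUnitary (Fin e × Fin (anc d e))).real (⋃ j, bad j) ≤
      d * Real.exp (-K * ε * d) := by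
    refine (measureReal_iUnion_fintype_le _).trans ?_
    refine (Finset.sum_le_sum fun j _ => hbad j).trans_eq ?_
    simp
  calc 1 - (d : ℝ) * Real.exp (-K * ε * d)
      ≤ 1 - (haarUnitary (Fin e × Fin (anc d e))).real (⋃ j, bad j) := by linarith
    _ = (haarUnitary (Fin e × Fin (anc d e))).real (⋃ j, bad j)ᶜ :=
        (probReal_compl_eq_one_sub (MeasurableSet.iUnion hbadMeas)).symm
    _ ≤ (haarUnitary (Fin e × Fin (anc d e))).real ((fun U => rotate U V₀) ⁻¹' _) :=
        measureReal_mono hgood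
    _ ≤ _ := ENNReal.toReal_mono (measure_ne_top _ _)
        (Measure.le_map_apply (continuous_rotate V₀).measurable.aemeasurable _)

end QEmbed

end

theorem theorem8 (ε : ℝ) (hε₀ : 0 < ε) (hε₁ : ε < 1) :
    -- the probability bound for a fixed pair of states
    (∀ (d e r : ℕ) (ρ σ : Matrix (Fin d) (Fin d) ℂ),
      QEmbed.IsState ρ → QEmbed.IsState σ → ρ.rank = r →
      2 * √((r : ℝ) * d / ε) ≤ e → e ≤ d →
      ∀ V₀ : QEmbed.EmbIsometry d e,
        1 - (d : ℝ) * Real.exp (-QEmbed.K * ε * d) ≤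
          (QEmbed.uniformIsometry V₀).real
            {V | (1 - ε) * QEmbed.traceNorm (ρ - σ) ≤
              QEmbed.traceNorm (QEmbed.isometryChannel V ρ - QEmbed.isometryChannel V σ)}) ∧
    -- states of rank at most `r` embed into `O(√(r d))` dimensions, for constant `ε`
    (∃ C : ℝ, 0 < C ∧ ∀ d r : ℕ, 1 ≤ r → r ≤ d →
      ∃ e : ℕ, 1 ≤ e ∧ e ≤ d ∧ (e : ℝ) ≤ C * √((r : ℝ) * d) ∧
        ∀ V₀ : QEmbed.EmbIsometry d e,
          QEmbed.IsQuantumEmbedding {ρ | QEmbed.IsState ρ ∧ ρ.rank ≤ r} ε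
            ((d : ℝ) * Real.exp (-QEmbed.K * ε * d))
            (QEmbed.uniformIsometry V₀) QEmbed.isometryChannel) := by
  refine ⟨fun d e r ρ σ hρ hσ hr he hed V₀ => ?_, 2 / √ε + 1, by positivity, fun d r hr hrd => ?_⟩
  · subst hr
    exact QEmbed.one_sub_le_uniformIsometry_real hε₀ hε₁ hρ hσ he hed V₀
  have hd : 0 < d := by omega
  have hrd1 : (1 : ℝ) ≤ √((r : ℝ) * d) := by
    rw [Real.one_le_sqrt]
    exact_mod_cast Nat.mul_pos hr hd
  have hsqrt : √((r : ℝ) * d / ε) = √((r : ℝ) * d) / √ε := Real.sqrt_div (by positivity) _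
  have hpos : 0 < √((r : ℝ) * d / ε) := by
    rw [hsqrt]
    have := Real.sqrt_pos.2 hε₀
    positivity
  by_cases hle : ⌈2 * √((r : ℝ) * d / ε)⌉₊ ≤ d
  · refine ⟨⌈2 * √((r : ℝ) * d / ε)⌉₊, Nat.one_le_ceil_iff.2 (by positivity), hle, ?_,
      fun V₀ => ⟨inferInstance, QEmbed.measurable_isometryChannel_apply,
        QEmbed.isChannel_isometryChannel, ?_⟩⟩
    · refine (Nat.ceil_lt_add_one (by positivity)).le.trans ?_
      rw [hsqrt, add_mul, one_mul]
      have : 2 * (√((r : ℝ) * d) / √ε) = 2 / √ε * √((r : ℝ) * d) := by ring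
      linarith
    · rintro ρ ⟨hρ, hρr⟩ σ ⟨hσ, -⟩
      have hρr' : (ρ.rank : ℝ) ≤ r := by exact_mod_cast hρr
      refine (QEmbed.one_sub_le_uniformIsometry_real hε₀ hε₁ hρ hσ
        (le_trans ?_ (Nat.le_ceil _)) hle V₀).trans (measureReal_mono fun V hV => ⟨hV, ?_⟩)
      · gcongr
      · rw [← map_sub]
        exact QEmbed.traceNorm_isometryChannel_le V (hρ.1.1.sub hσ.1.1)
  · refine ⟨d, hd, le_rfl, ?_, fun V₀ => ⟨inferInstance, QEmbed.measurable_isometryChannel_apply,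
      QEmbed.isChannel_isometryChannel, ?_⟩⟩
    · have h1 : (d : ℝ) < 2 * √((r : ℝ) * d / ε) := Nat.lt_ceil.1 (not_le.1 hle)
      rw [hsqrt] at h1
      have : 2 * (√((r : ℝ) * d) / √ε) = 2 / √ε * √((r : ℝ) * d) := by ring
      rw [add_mul]
      linarith
    · rintro ρ - σ -
      have huniv : {V : QEmbed.EmbIsometry d d | (1 - ε) * QEmbed.traceNorm (ρ - σ) ≤
          QEmbed.traceNorm (QEmbed.isometryChannel V ρ - QEmbed.isometryChannel V σ) ∧
          QEmbed.traceNorm (QEmbed.isometryChannel V ρ - QEmbed.isometryChannel V σ) ≤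
          QEmbed.traceNorm (ρ - σ)} = Set.univ := by
        refine Set.eq_univ_of_forall fun V => ?_
        have h0 : 0 ≤ QEmbed.traceNorm (ρ - σ) := Finset.sum_nonneg fun i _ => Real.sqrt_nonneg _
        have h1 : QEmbed.traceNorm (QEmbed.isometryChannel V ρ - QEmbed.isometryChannel V σ) =
            QEmbed.traceNorm (ρ - σ) := by
          rw [← map_sub, QEmbed.traceNorm_isometryChannel_of_dim_eq hd]
        change _ ≤ _ ∧ _ ≤ _
        rw [h1]
        exact ⟨by nlinarith, le_rfl⟩
      rw [huniv, probReal_univ]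
      have : 0 ≤ (d : ℝ) * Real.exp (-QEmbed.K * ε * d) := by positivity
      linarith
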